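/- Let $\mathbb{K}$ be a field of characteristic $0$ and let $\mathcal{D}$ be a non-empty class of finite groups closed under subquotients (hence under isomorphism) and direct products, for instance the class of all finite groups. Let $\mathbb{K}\mathcal{D}$ be the category with objects the groups in $\mathcal{D}$ and $\mathrm{Hom}(G,H)=\mathbb{K}\otimes_{\mathbb{Z}}B(H,G)$, where $B(H,G)$ is the Grothendieck group of finite $(H,G)$-bisets with respect to disjoint unions; composition is induced by the tensor product of bisets. Let $A$ be a Green biset functor over $\mathbb{K}\mathcal{D}$, i.e. a $\mathbb{K}$-linear functor from $\mathbb{K}\mathcal{D}$ to $\mathbb{K}$-modules, with bilinear products $A(G)\times A(H)\to A(G\times H)$, $(a,b)\mapsto a\times b$, and an element $\xi_A\in A(1)$, which are associative and unital (up to the canonical isomorphisms $G\times(H\times K)\cong(G\times H)\times K$, $1\times G\cong G\cong G\times 1$) and functorial: $A(\varphi\times\psi)(a\times b)=A(\varphi)(a)\times A(\psi)(b)$ for all morphisms $\varphi,\psi$ of $\mathbb{K}\mathcal{D}$. Each $A(G)$ is a $\mathbb{K}$-algebra with product $a\cdot b=A(\mathrm{Iso}^{G}_{\Delta(G)}\circ\mathrm{Res}^{G\times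 G}_{\Delta(G)})(a\times b)$, where $\Delta(G)\le G\times G$ is the diagonal subgroup, and unity $A(\mathrm{Inf}_1^G)(\xi_A)$. Assume that for every $G$ in $\mathcal{D}$ this algebra is a finite dimensional split semisimple commutative $\mathbb{K}$-algebra, i.e. isomorphic as an algebra to $\mathbb{K}^n$ for some $n\ge 0$ depending on $G$. An ideal of $A$ is a biset subfunctor $I$ of $A$ (submodules $I(G)\subseteq A(G)$ stable under all morphisms of $\mathbb{K}\mathcal{D}$) such that $A(G)\times I(H)\subseteq I(G\times H)$ and $I(G)\times A(H)\subseteq I(G\times H)$ for all $G,H$ in $\mathcal{D}$. Let $\mathcal{S}_A$ be the collection of ideals of $A$, ordered by inclusion ($I\subseteq J$ if $I(G)\subseteq J(G)$ for all $G$). Then $\mathcal{S}_A$ is a distributive lattice, in which the join of $I$ and $J$ is their sum, $(I+J)(G)=I(G)+J(G)$, and the meet is their intersection, $(I\cap J)(G)=I(G)\cap J(G)$. -/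

import Mathlib

open CategoryTheory
open scoped TensorProduct

universe u v w

/-! ## Finite bisets -/

/-- A finite `(H, G)`-biset: a finite set with a left action of `H` and a right action of `G`
(a left action of the opposite group `Gᵐᵒᵖ`) which commute. -/
structure FinBiset (H G : Type u) [Group H] [Group G] where
  carrier : Type u
  [finite : Finite carrier]
  [left : MulAction H carrier]
  [right : MulAction Gᵐᵒᵖ carrier]
  [comm : SMulCommClass H Gᵐᵒᵖ carrier]

namespace FinBiset

variable {H G K L H' G' K' : Type u} [Group H] [Group G] [Group K] [Group L]
  [Group H'] [Group G'] [Group K']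

instance : CoeSort (FinBiset H G) (Type u) := ⟨FinBiset.carrier⟩

attribute [instance] FinBiset.finite FinBiset.left FinBiset.right FinBiset.comm

/-- The right action `x · g`. -/
def rsmul {U : FinBiset H G} (x : U) (g : G) : U := MulOpposite.op g • x

theorem rsmul_one {U : FinBiset H G} (x : U) : rsmul x (1 : G) = x := one_smul Gᵐᵒᵖ x

theorem rsmul_mul {U : FinBiset H G} (x : U) (g g' : G) :
    rsmul x (g * g') = rsmul (rsmul x g) g' := mul_smul (MulOpposite.op g') (MulOpposite.op g) x

theorem smul_rsmul {U : FinBiset H G} (h : H) (x : U) (g : G) :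
    h • rsmul x g = rsmul (h • x) g := smul_comm h (MulOpposite.op g) x

/-- The biset with prescribed commuting left and right actions. -/
def mk' (X : Type u) [Finite X] (l : H → X → X) (r : X → G → X)
    (one_l : ∀ x, l 1 x = x) (mul_l : ∀ h h' x, l (h * h') x = l h (l h' x))
    (r_one : ∀ x, r x 1 = x) (r_mul : ∀ x g g', r x (g * g') = r (r x g) g')
    (l_r : ∀ h x g, l h (r x g) = r (l h x) g) : FinBiset H G :=
  letI : MulAction H X := { smul := l, one_smul := one_l, mul_smul := mul_l }
  letI : MulAction Gᵐᵒᵖ X :=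
    { smul := fun g x => r x g.unop
      one_smul := r_one
      mul_smul := fun g g' x => r_mul x g'.unop g.unop }
  letI : SMulCommClass H Gᵐᵒᵖ X := ⟨fun h g x => l_r h x g.unop⟩
  { carrier := X }

/-- An isomorphism of bisets: a bijection which commutes with both actions. -/
structure Iso (U V : FinBiset H G) where
  toEquiv : U ≃ V
  map_smul : ∀ (h : H) (x : U), toEquiv (h • x) = h • toEquiv x
  map_rsmul : ∀ (x : U) (g : G), toEquiv (rsmul x g) = rsmul (toEquiv x) g

/-- Build an isomorphism from mutually inverse maps. -/
def Iso.ofMaps {U V : FinBiset H G} (f : U → V) (g : V → U) (gf : ∀ x, g (f x) = x)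
    (fg : ∀ y, f (g y) = y) (hl : ∀ (h : H) (x : U), f (h • x) = h • f x)
    (hr : ∀ (x : U) (g : G), f (rsmul x g) = rsmul (f x) g) : Iso U V :=
  ⟨⟨f, g, gf, fg⟩, hl, hr⟩

def Iso.refl (U : FinBiset H G) : Iso U U := ⟨Equiv.refl _, fun _ _ => rfl, fun _ _ => rfl⟩

def Iso.symm {U V : FinBiset H G} (e : Iso U V) : Iso V U where
  toEquiv := e.toEquiv.symm
  map_smul h x := by rw [Equiv.symm_apply_eq, e.map_smul, Equiv.apply_symm_apply]
  map_rsmul x g := by rw [Equiv.symm_apply_eq, e.map_rsmul, Equiv.apply_symm_apply]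

def Iso.trans {U V W : FinBiset H G} (e : Iso U V) (f : Iso V W) : Iso U W where
  toEquiv := e.toEquiv.trans f.toEquiv
  map_smul h x := by simp [e.map_smul, f.map_smul]
  map_rsmul x g := by simp [e.map_rsmul, f.map_rsmul]

/-! ### Operations on bisets -/

/-- The empty biset. -/
def empty (H G : Type u) [Group H] [Group G] : FinBiset H G :=
  mk' PEmpty (fun _ x => x) (fun x _ => x) (fun _ => rfl) (fun _ _ _ => rfl) (fun _ => rfl)
    (fun _ _ _ => rfl) (fun _ _ _ => rfl)

/-- The disjoint union of two bisets. -/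
def sum (U V : FinBiset H G) : FinBiset H G :=
  mk' (U ⊕ V) (fun h => Sum.map (h • ·) (h • ·))
    (fun x g => Sum.map (rsmul · g) (rsmul · g) x)
    (by rintro (x | x) <;> simp) (by rintro h h' (x | x) <;> simp [mul_smul])
    (by rintro (x | x) <;> simp [rsmul_one])
    (by rintro (x | x) g g' <;> simp [rsmul_mul])
    (by rintro h (x | x) g <;> simp [smul_rsmul])

/-- The relation `(v · h, u) ∼ (v, h · u)` on `V × U`. -/
def tensorRel (V : FinBiset K H) (U : FinBiset H G) (p q : V × U) : Prop :=
  ∃ h : H, p.1 = rsmul q.1 h ∧ q.2 = h • p.2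

/-- The tensor product `V ×_H U` of a `(K, H)`-biset and an `(H, G)`-biset: the quotient of `V × U`
by the (equivalence) relation `(v · h, u) ∼ (v, h · u)`. -/
def tensor (V : FinBiset K H) (U : FinBiset H G) : FinBiset K G :=
  mk' (Quot (tensorRel V U))
    (fun k => Quot.map (fun p => (k • p.1, p.2))
      (by rintro p q ⟨h, h1, h2⟩; exact ⟨h, by simp [h1, smul_rsmul], h2⟩))
    (fun x g => Quot.map (fun p => (p.1, rsmul p.2 g))
      (by rintro p q ⟨h, h1, h2⟩; exact ⟨h, h1, by simp [h2, smul_rsmul]⟩) x)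
    (by rintro ⟨p⟩; simp [Quot.map]) (by rintro k k' ⟨p⟩; simp [Quot.map, mul_smul])
    (by rintro ⟨p⟩; simp [Quot.map, rsmul_one])
    (by rintro ⟨p⟩ g g'; simp [Quot.map, rsmul_mul])
    (by rintro k ⟨p⟩ g; simp [Quot.map])

/-- The cartesian product of an `(H, G)`-biset and an `(H', G')`-biset, as an
`(H × H', G × G')`-biset. -/
def cross (U : FinBiset H G) (V : FinBiset H' G') : FinBiset (H × H') (G × G') :=
  mk' (U × V) (fun h x => (h.1 • x.1, h.2 • x.2)) (fun x g => (rsmul x.1 g.1, rsmul x.2 g.2))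
    (by rintro ⟨x, y⟩; simp) (by rintro h h' ⟨x, y⟩; simp [mul_smul])
    (by rintro ⟨x, y⟩; simp [rsmul_one])
    (by rintro ⟨x, y⟩ g g'; simp [rsmul_mul])
    (by rintro h ⟨x, y⟩ g; simp [smul_rsmul])

/-- For a homomorphism `φ : K → G`, the set `G` as a `(K, G)`-biset, where `k · x · g = φ(k) x g`.
It is the restriction if `φ` is the inclusion of a subgroup, the inflation if `φ` is surjective. -/
def res [Finite G] (φ : K →* G) : FinBiset K G :=
  mk' G (fun k x => φ k * x) (fun x g => x * g) (by simp) (by simp [mul_assoc]) (by simp)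
    (by simp [mul_assoc]) (by simp [mul_assoc])

/-- For a homomorphism `φ : K → G`, the set `G` as a `(G, K)`-biset, where `g · x · k = g x φ(k)`.
If `φ` is an isomorphism, this is the biset `Iso φ`. -/
def ind [Finite G] (φ : K →* G) : FinBiset G K :=
  mk' G (fun g x => g * x) (fun x k => x * φ k) (by simp) (by simp [mul_assoc]) (by simp)
    (by simp [mul_assoc]) (by simp [mul_assoc])

/-! ### Compatibility of the operations with isomorphisms -/

def sumCongr {U U' V V' : FinBiset H G} (e : Iso U U') (f : Iso V V') :
    Iso (sum U V) (sum U' V') where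
  toEquiv := Equiv.sumCongr e.toEquiv f.toEquiv
  map_smul := by
    rintro h (x | x)
    · exact congrArg Sum.inl (e.map_smul h x)
    · exact congrArg Sum.inr (f.map_smul h x)
  map_rsmul := by
    rintro (x | x) g
    · exact congrArg Sum.inl (e.map_rsmul x g)
    · exact congrArg Sum.inr (f.map_rsmul x g)

def sumComm (U V : FinBiset H G) : Iso (sum U V) (sum V U) where
  toEquiv := Equiv.sumComm U V
  map_smul := by rintro h (x | x) <;> rfl
  map_rsmul := by rintro (x | x) g <;> rfl

def sumAssoc (U V W : FinBiset H G) : Iso (sum (sum U V) W) (sum U (sum V W)) where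
  toEquiv := Equiv.sumAssoc U V W
  map_smul := by rintro h ((x | x) | x) <;> rfl
  map_rsmul := by rintro ((x | x) | x) g <;> rfl

def emptySum (U : FinBiset H G) : Iso (sum (empty H G) U) U where
  toEquiv := Equiv.emptySum PEmpty U
  map_smul := by rintro h (⟨⟨⟩⟩ | x); rfl
  map_rsmul := by rintro (⟨⟨⟩⟩ | x) g; rfl

/-- The class of `(v, u)` in `V ×_H U`. -/
def tmk {V : FinBiset K H} {U : FinBiset H G} (v : V) (u : U) : tensor V U :=
  Quot.mk (tensorRel V U) (v, u)

theorem smul_tmk {V : FinBiset K H} {U : FinBiset H G} (k : K) (v : V) (u : U) :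
    k • tmk v u = tmk (k • v) u := rfl

theorem tmk_rsmul {V : FinBiset K H} {U : FinBiset H G} (v : V) (u : U) (g : G) :
    rsmul (tmk v u) g = tmk v (rsmul u g) := rfl

theorem tmk_balanced {V : FinBiset K H} {U : FinBiset H G} (v : V) (h : H) (u : U) :
    tmk (rsmul v h) u = tmk v (h • u) := Quot.sound ⟨h, rfl, rfl⟩

/-- A map out of the tensor product. -/
def tlift {V : FinBiset K H} {U : FinBiset H G} {X : Type u} (f : V → U → X)
    (hf : ∀ v h u, f (rsmul v h) u = f v (h • u)) (x : tensor V U) : X :=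
  Quot.lift (fun p : V × U => f p.1 p.2)
    (by rintro ⟨v, u⟩ ⟨v', u'⟩ ⟨h, h1, h2⟩; simp only at h1 h2; subst h1 h2; exact hf _ _ _) x

theorem tensor_ind {V : FinBiset K H} {U : FinBiset H G} {P : tensor V U → Prop}
    (h : ∀ v u, P (tmk v u)) (x : tensor V U) : P x :=
  Quot.ind (fun p => h p.1 p.2) x

def tensorCongr {V V' : FinBiset K H} {U U' : FinBiset H G} (e : Iso V V') (f : Iso U U') :
    Iso (tensor V U) (tensor V' U') :=
  Iso.ofMaps
    (tlift (fun v u => tmk (e.toEquiv v) (f.toEquiv u))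
      (fun v h u => by rw [e.map_rsmul, f.map_smul, tmk_balanced]))
    (tlift (fun v u => tmk (e.symm.toEquiv v) (f.symm.toEquiv u))
      (fun v h u => by rw [e.symm.map_rsmul, f.symm.map_smul, tmk_balanced]))
    (by intro x
        induction x using tensor_ind with
        | h v u =>
          exact congrArg₂ tmk (e.toEquiv.symm_apply_apply v) (f.toEquiv.symm_apply_apply u))
    (by intro x
        induction x using tensor_ind with
        | h v u =>
          exact congrArg₂ tmk (e.toEquiv.apply_symm_apply v) (f.toEquiv.apply_symm_apply u))
    (by intro k x
        induction x using tensor_ind with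
        | h v u => exact congrArg (fun z => tmk z (f.toEquiv u)) (e.map_smul k v))
    (by intro x g
        induction x using tensor_ind with
        | h v u => exact congrArg (fun z => tmk (e.toEquiv v) z) (f.map_rsmul u g))

def sumTensor (V V' : FinBiset K H) (U : FinBiset H G) :
    Iso (tensor (sum V V') U) (sum (tensor V U) (tensor V' U)) :=
  Iso.ofMaps
    (tlift (fun v u => Sum.elim (fun v => Sum.inl (tmk v u)) (fun v => Sum.inr (tmk v u)) v)
      (by rintro (v | v) h u
          · exact congrArg Sum.inl (tmk_balanced v h u)
          · exact congrArg Sum.inr (tmk_balanced v h u)))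
    (Sum.elim
      (tlift (fun v u => tmk (V := sum V V') (Sum.inl v) u)
        (fun v h u => tmk_balanced (V := sum V V') (Sum.inl v) h u))
      (tlift (fun v u => tmk (V := sum V V') (Sum.inr v) u)
        (fun v h u => tmk_balanced (V := sum V V') (Sum.inr v) h u)))
    (by intro x
        induction x using tensor_ind with
        | h v u => rcases v with v | v <;> rfl)
    (by rintro (x | x)
        · induction x using tensor_ind with
          | h v u => rfl
        · induction x using tensor_ind with
          | h v u => rfl)
    (by intro k x
        induction x using tensor_ind with
        | h v u => rcases v with v | v <;> rfl)
    (by intro x g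
        induction x using tensor_ind with
        | h v u => rcases v with v | v <;> rfl)

def tensorSum (V : FinBiset K H) (U U' : FinBiset H G) :
    Iso (tensor V (sum U U')) (sum (tensor V U) (tensor V U')) :=
  Iso.ofMaps
    (tlift (fun v u => Sum.elim (fun u => Sum.inl (tmk v u)) (fun u => Sum.inr (tmk v u)) u)
      (by rintro v h (u | u)
          · exact congrArg Sum.inl (tmk_balanced v h u)
          · exact congrArg Sum.inr (tmk_balanced v h u)))
    (Sum.elim
      (tlift (fun v u => tmk (U := sum U U') v (Sum.inl u))
        (fun v h u => tmk_balanced (U := sum U U') v h (Sum.inl u)))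
      (tlift (fun v u => tmk (U := sum U U') v (Sum.inr u))
        (fun v h u => tmk_balanced (U := sum U U') v h (Sum.inr u))))
    (by intro x
        induction x using tensor_ind with
        | h v u => rcases u with u | u <;> rfl)
    (by rintro (x | x)
        · induction x using tensor_ind with
          | h v u => rfl
        · induction x using tensor_ind with
          | h v u => rfl)
    (by intro k x
        induction x using tensor_ind with
        | h v u => rcases u with u | u <;> rfl)
    (by intro x g
        induction x using tensor_ind with
        | h v u => rcases u with u | u <;> rfl)

def emptyTensor (U : FinBiset H G) : Iso (tensor (empty K H) U) (empty K G) :=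
  Iso.ofMaps (tlift (fun v _ => v) (fun _ _ _ => rfl)) (fun x => PEmpty.elim x)
    (by intro x
        induction x using tensor_ind with
        | h v u => exact PEmpty.elim v)
    (by rintro ⟨⟩)
    (by intro k x
        induction x using tensor_ind with
        | h v u => exact PEmpty.elim v)
    (by intro x g
        induction x using tensor_ind with
        | h v u => exact PEmpty.elim v)

def tensorEmpty (V : FinBiset K H) : Iso (tensor V (empty H G)) (empty K G) :=
  Iso.ofMaps (tlift (fun _ u => u) (fun _ _ _ => rfl)) (fun x => PEmpty.elim x)
    (by intro x
        induction x using tensor_ind with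
        | h v u => exact PEmpty.elim u)
    (by rintro ⟨⟩)
    (by intro k x
        induction x using tensor_ind with
        | h v u => exact PEmpty.elim u)
    (by intro x g
        induction x using tensor_ind with
        | h v u => exact PEmpty.elim u)

def tensorAssoc (W : FinBiset L K) (V : FinBiset K H) (U : FinBiset H G) :
    Iso (tensor (tensor W V) U) (tensor W (tensor V U)) :=
  Iso.ofMaps
    (tlift (fun x u => tlift (fun w v => tmk w (tmk v u))
        (fun w k v => tmk_balanced w k (tmk v u)) x)
      (by intro x h u
          induction x using tensor_ind with
          | h w v => exact congrArg (tmk w) (tmk_balanced v h u)))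
    (tlift (fun w x => tlift (fun v u => tmk (tmk w v) u)
        (fun v h u => tmk_balanced (tmk w v) h u) x)
      (by intro w k x
          induction x using tensor_ind with
          | h v u => exact congrArg (fun z => tmk z u) (tmk_balanced w k v)))
    (by intro x
        induction x using tensor_ind with
        | h y u =>
          induction y using tensor_ind with
          | h w v => rfl)
    (by intro x
        induction x using tensor_ind with
        | h w y =>
          induction y using tensor_ind with
          | h v u => rfl)
    (by intro l x
        induction x using tensor_ind with
        | h y u =>
          induction y using tensor_ind with
          | h w v => rfl)
    (by intro x g
        induction x using tensor_ind with
        | h y u =>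
          induction y using tensor_ind with
          | h w v => rfl)

/-- The identity biset of `G`: the set `G` with both multiplication actions. -/
def idBiset (G : Type u) [Group G] [Finite G] : FinBiset G G := ind (MonoidHom.id G)

def idTensor [Finite H] (U : FinBiset H G) : Iso (tensor (idBiset H) U) U :=
  Iso.ofMaps (tlift (V := idBiset H) (fun v u => (show H from v) • u)
      (fun v h u => mul_smul (show H from v) h u))
    (fun u => tmk (V := idBiset H) (1 : H) u)
    (by intro x
        induction x using tensor_ind with
        | h v u =>
          refine (tmk_balanced (V := idBiset H) (1 : H) v u).symm.trans ?_
          exact congrArg (fun z => tmk (V := idBiset H) z u) (one_mul (show H from v)))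
    (fun u => one_smul H u)
    (by intro k x
        induction x using tensor_ind with
        | h v u => exact mul_smul k (show H from v) u)
    (by intro x g
        induction x using tensor_ind with
        | h v u => exact smul_rsmul (show H from v) u g)

def tensorId [Finite G] (U : FinBiset H G) : Iso (tensor U (idBiset G)) U :=
  Iso.ofMaps (tlift (U := idBiset G) (fun u g => rsmul u (show G from g))
      (fun u g g' => (rsmul_mul u g (show G from g')).symm))
    (fun u => tmk (U := idBiset G) u (1 : G))
    (by intro x
        induction x using tensor_ind with
        | h u g =>
          refine (tmk_balanced (U := idBiset G) u g (1 : G)).trans ?_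
          exact congrArg (fun z => tmk (U := idBiset G) u z) (mul_one (show G from g)))
    (fun u => rsmul_one u)
    (by intro k x
        induction x using tensor_ind with
        | h u g => exact (smul_rsmul k u (show G from g)).symm)
    (by intro x g
        induction x using tensor_ind with
        | h u g' => exact rsmul_mul u (show G from g') g)

def crossCongr {U U' : FinBiset H G} {V V' : FinBiset H' G'} (e : Iso U U') (f : Iso V V') :
    Iso (cross U V) (cross U' V') where
  toEquiv := Equiv.prodCongr e.toEquiv f.toEquiv
  map_smul := fun h x => congrArg₂ Prod.mk (e.map_smul h.1 x.1) (f.map_smul h.2 x.2)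
  map_rsmul := fun x g => congrArg₂ Prod.mk (e.map_rsmul x.1 g.1) (f.map_rsmul x.2 g.2)

def sumCross (U U' : FinBiset H G) (V : FinBiset H' G') :
    Iso (cross (sum U U') V) (sum (cross U V) (cross U' V)) where
  toEquiv := Equiv.sumProdDistrib U U' V
  map_smul := by rintro h ⟨x | x, y⟩ <;> rfl
  map_rsmul := by rintro ⟨x | x, y⟩ g <;> rfl

def crossSum (U : FinBiset H G) (V V' : FinBiset H' G') :
    Iso (cross U (sum V V')) (sum (cross U V) (cross U V')) where
  toEquiv := Equiv.prodSumDistrib U V V'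
  map_smul := by rintro h ⟨x, y | y⟩ <;> rfl
  map_rsmul := by rintro ⟨x, y | y⟩ g <;> rfl

def emptyCross (V : FinBiset H' G') : Iso (cross (empty H G) V) (empty _ _) :=
  Iso.ofMaps Prod.fst (fun x => PEmpty.elim x) (by rintro ⟨⟨⟩, _⟩) (by rintro ⟨⟩)
    (by rintro _ ⟨⟨⟩, _⟩) (by rintro ⟨⟨⟩, _⟩)

def crossEmpty (U : FinBiset H G) : Iso (cross U (empty H' G')) (empty _ _) :=
  Iso.ofMaps Prod.snd (fun x => PEmpty.elim x) (by rintro ⟨_, ⟨⟩⟩) (by rintro ⟨⟩)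
    (by rintro _ ⟨_, ⟨⟩⟩) (by rintro ⟨_, ⟨⟩⟩)

/-! ### Isomorphism classes -/

instance setoid (H G : Type u) [Group H] [Group G] : Setoid (FinBiset H G) where
  r U V := Nonempty (Iso U V)
  iseqv := ⟨fun U => ⟨Iso.refl U⟩, fun ⟨e⟩ => ⟨e.symm⟩, fun ⟨e⟩ ⟨f⟩ => ⟨e.trans f⟩⟩

end FinBiset

/-- The isomorphism classes of finite `(H, G)`-bisets. -/
def BisetClass (H G : Type u) [Group H] [Group G] : Type (u + 1) := Quotient (FinBiset.setoid H G)

namespace BisetClass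

variable {H G K L H' G' : Type u} [Group H] [Group G] [Group K] [Group L] [Group H'] [Group G']

/-- The isomorphism class of a biset. -/
def mk (U : FinBiset H G) : BisetClass H G := Quotient.mk _ U

theorem mk_eq {U V : FinBiset H G} (e : FinBiset.Iso U V) : mk U = mk V := Quotient.sound ⟨e⟩

theorem ind {P : BisetClass H G → Prop} (h : ∀ U, P (mk U)) (x : BisetClass H G) : P x :=
  Quotient.ind h x

/-- The operation on isomorphism classes induced by an operation on bisets. -/
def map₂ (f : FinBiset H G → FinBiset H' G' → FinBiset K L)
    (hf : ∀ {U U' : FinBiset H G} {V V' : FinBiset H' G'},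
      FinBiset.Iso U U' → FinBiset.Iso V V' → FinBiset.Iso (f U V) (f U' V')) :
    BisetClass H G → BisetClass H' G' → BisetClass K L :=
  Quotient.map₂ f (fun _ _ ⟨e⟩ _ _ ⟨e'⟩ => ⟨hf e e'⟩)

instance : Zero (BisetClass H G) := ⟨mk (FinBiset.empty H G)⟩

instance : Add (BisetClass H G) := ⟨map₂ FinBiset.sum FinBiset.sumCongr⟩

/-- Isomorphism classes form a commutative monoid under disjoint union. -/
instance : AddCommMonoid (BisetClass H G) where
  add_assoc := by
    rintro ⟨U⟩ ⟨V⟩ ⟨W⟩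
    exact mk_eq (FinBiset.sumAssoc U V W)
  zero_add := by
    rintro ⟨U⟩
    exact mk_eq (FinBiset.emptySum U)
  add_zero := by
    rintro ⟨U⟩
    exact mk_eq ((FinBiset.sumComm _ _).trans (FinBiset.emptySum U))
  add_comm := by
    rintro ⟨U⟩ ⟨V⟩
    exact mk_eq (FinBiset.sumComm U V)
  nsmul := nsmulRec

/-- The tensor product on isomorphism classes. -/
def comp : BisetClass K H →+ BisetClass H G →+ BisetClass K G where
  toFun V :=
    { toFun := fun U => map₂ FinBiset.tensor FinBiset.tensorCongr V U
      map_zero' := by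
        revert V
        rintro ⟨V⟩
        exact mk_eq (FinBiset.tensorEmpty V)
      map_add' := by
        revert V
        rintro ⟨V⟩ ⟨U⟩ ⟨U'⟩
        exact mk_eq (FinBiset.tensorSum V U U') }
  map_zero' := by
    ext ⟨U⟩
    exact mk_eq (FinBiset.emptyTensor U)
  map_add' := by
    rintro ⟨V⟩ ⟨V'⟩
    ext ⟨U⟩
    exact mk_eq (FinBiset.sumTensor V V' U)

theorem comp_mk (V : FinBiset K H) (U : FinBiset H G) :
    comp (mk V) (mk U) = mk (V.tensor U) := rfl

/-- The cartesian product on isomorphism classes. -/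
def cross : BisetClass H G →+ BisetClass H' G' →+ BisetClass (H × H') (G × G') where
  toFun U :=
    { toFun := fun V => map₂ FinBiset.cross FinBiset.crossCongr U V
      map_zero' := by
        revert U
        rintro ⟨U⟩
        exact mk_eq (FinBiset.crossEmpty U)
      map_add' := by
        revert U
        rintro ⟨U⟩ ⟨V⟩ ⟨V'⟩
        exact mk_eq (FinBiset.crossSum U V V') }
  map_zero' := by
    ext ⟨V⟩
    exact mk_eq (FinBiset.emptyCross V)
  map_add' := by
    rintro ⟨U⟩ ⟨U'⟩
    ext ⟨V⟩
    exact mk_eq (FinBiset.sumCross U U' V)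

theorem cross_mk (U : FinBiset H G) (V : FinBiset H' G') :
    cross (mk U) (mk V) = mk (U.cross V) := rfl

end BisetClass

/-! ## Extension of scalars of Grothendieck groups -/

/-- The `R`-module `R ⊗ K₀(M)`, where `K₀(M)` is the Grothendieck group of `M`. -/
abbrev GrothModule (R : Type v) [CommRing R] (M : Type w) [AddCommMonoid M] : Type (max v w) :=
  R ⊗[ℤ] Algebra.GrothendieckAddGroup M

namespace GrothModule

variable (R : Type v) [CommRing R] {M M' M'' : Type w} [AddCommMonoid M] [AddCommMonoid M']
  [AddCommMonoid M'']

/-- The class of an element of `M`. -/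
noncomputable def cls (m : M) : GrothModule R M := 1 ⊗ₜ Algebra.GrothendieckAddGroup.of m

variable {R}

theorem groth_ext {N : Type*} [AddCommGroup N] {f g : Algebra.GrothendieckAddGroup M →+ N}
    (h : ∀ m, f (Algebra.GrothendieckAddGroup.of m) = g (Algebra.GrothendieckAddGroup.of m)) :
    f = g :=
  Algebra.GrothendieckAddGroup.lift.symm.injective (AddMonoidHom.ext h)

theorem ext {N : Type*} [AddCommGroup N] [Module R N] {f g : GrothModule R M →ₗ[R] N}
    (h : ∀ m, f (cls R m) = g (cls R m)) : f = g := by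
  apply TensorProduct.AlgebraTensorModule.curry_injective
  apply LinearMap.ext_ring
  apply LinearMap.toAddMonoidHom_injective
  exact groth_ext h

theorem lift_of {N : Type*} [AddCommGroup N] (f : M →+ N) (m : M) :
    Algebra.GrothendieckAddGroup.lift f (Algebra.GrothendieckAddGroup.of m) = f m :=
  DFunLike.congr_fun (Algebra.GrothendieckAddGroup.lift.symm_apply_apply f) m

/-- The biadditive extension of a biadditive map to Grothendieck groups. -/
noncomputable def grothMap₂ (f : M →+ M' →+ M'') :
    Algebra.GrothendieckAddGroup M →+ Algebra.GrothendieckAddGroup M' →+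
      Algebra.GrothendieckAddGroup M'' :=
  Algebra.GrothendieckAddGroup.lift
    { toFun := fun m =>
        Algebra.GrothendieckAddGroup.lift (Algebra.GrothendieckAddGroup.of.comp (f m))
      map_zero' := groth_ext fun m' => by rw [lift_of]; simp
      map_add' := fun m n => groth_ext fun m' => by
        rw [AddMonoidHom.add_apply, lift_of, lift_of, lift_of]; simp }

variable (R) in
/-- The `R`-bilinear extension of a biadditive map. -/
noncomputable def map₂ (f : M →+ M' →+ M'') :
    GrothModule R M →ₗ[R] GrothModule R M' →ₗ[R] GrothModule R M'' :=
  LinearMap.liftBaseChange R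
    ((LinearMap.baseChangeHom ℤ R _ _).comp
      (AddMonoidHom.toIntLinearMap
        { toFun := fun x => (grothMap₂ f x).toIntLinearMap
          map_zero' := by ext; simp
          map_add' := fun x y => by ext; simp }))

theorem map₂_cls (f : M →+ M' →+ M'') (m : M) (m' : M') :
    map₂ R f (cls R m) (cls R m') = cls R (f m m') := by
  have h : grothMap₂ f (Algebra.GrothendieckAddGroup.of m) (Algebra.GrothendieckAddGroup.of m') =
      Algebra.GrothendieckAddGroup.of (f m m') := by
    rw [grothMap₂, lift_of]
    exact lift_of _ m'
  simp only [map₂, cls, LinearMap.liftBaseChange_tmul, one_smul]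
  exact congrArg (fun z => (1 : R) ⊗ₜ[ℤ] z) h

end GrothModule

/-! ## The biset category -/

/-- `RB(H, G)`: the Grothendieck group of finite `(H, G)`-bisets for disjoint unions,
with coefficients in `R`. -/
abbrev RB (R : Type v) [CommRing R] (H G : Type u) [Group H] [Group G] : Type (max v (u + 1)) :=
  GrothModule R (BisetClass H G)

namespace RB

variable (R : Type v) [CommRing R] {H G K L H' G' : Type u} [Group H] [Group G] [Group K]
  [Group L] [Group H'] [Group G']

/-- The class of a biset in `RB(H, G)`. -/
noncomputable def of (U : FinBiset H G) : RB R H G := GrothModule.cls R (BisetClass.mk U)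

variable {R}

theorem ext {N : Type*} [AddCommGroup N] [Module R N] {f g : RB R H G →ₗ[R] N}
    (h : ∀ U, f (of R U) = g (of R U)) : f = g :=
  GrothModule.ext fun m => BisetClass.ind (P := fun m => f (GrothModule.cls R m) = g (GrothModule.cls R m)) h m

theorem of_eq {U V : FinBiset H G} (e : FinBiset.Iso U V) : of R U = of R V :=
  congrArg (GrothModule.cls R) (BisetClass.mk_eq e)

variable (R) in
/-- The composition `RB(K, H) × RB(H, G) → RB(K, G)`, extending the tensor product of bisets
bilinearly. -/
noncomputable def comp : RB R K H →ₗ[R] RB R H G →ₗ[R] RB R K G :=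
  GrothModule.map₂ R BisetClass.comp

theorem comp_of (V : FinBiset K H) (U : FinBiset H G) :
    comp R (of R V) (of R U) = of R (V.tensor U) :=
  GrothModule.map₂_cls _ _ _

variable (R) in
/-- The product `RB(H, G) × RB(H', G') → RB(H × H', G × G')`, extending the cartesian product of
bisets bilinearly. -/
noncomputable def cross : RB R H G →ₗ[R] RB R H' G' →ₗ[R] RB R (H × H') (G × G') :=
  GrothModule.map₂ R BisetClass.cross

theorem cross_of (U : FinBiset H G) (V : FinBiset H' G') :
    cross R (of R U) (of R V) = of R (U.cross V) :=
  GrothModule.map₂_cls _ _ _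

theorem id_comp [Finite H] (x : RB R H G) : comp R (of R (FinBiset.idBiset H)) x = x := by
  have : comp R (of R (FinBiset.idBiset H)) = (LinearMap.id : RB R H G →ₗ[R] RB R H G) :=
    ext fun U => (comp_of _ _).trans (of_eq (FinBiset.idTensor U))
  exact LinearMap.congr_fun this x

theorem comp_id [Finite G] (x : RB R H G) : comp R x (of R (FinBiset.idBiset G)) = x := by
  have : (comp R).flip (of R (FinBiset.idBiset G)) = (LinearMap.id : RB R H G →ₗ[R] RB R H G) :=
    ext fun U => (comp_of _ _).trans (of_eq (FinBiset.tensorId U))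
  exact LinearMap.congr_fun this x

theorem comp_assoc (z : RB R L K) (y : RB R K H) (x : RB R H G) :
    comp R (comp R z y) x = comp R z (comp R y x) := by
  have h1 (W : FinBiset L K) (V : FinBiset K H) (x : RB R H G) :
      comp R (comp R (of R W) (of R V)) x = comp R (of R W) (comp R (of R V) x) := by
    have : comp R (comp R (of R W) (of R V)) =
        (comp R (of R W)).comp (comp R (H := H) (G := G) (of R V)) :=
      ext fun U => by
        rw [LinearMap.comp_apply, comp_of, comp_of, comp_of, comp_of]
        exact of_eq (FinBiset.tensorAssoc W V U)
    exact LinearMap.congr_fun this x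
  have h2 (W : FinBiset L K) (y : RB R K H) (x : RB R H G) :
      comp R (comp R (of R W) y) x = comp R (of R W) (comp R y x) := by
    have : ((comp R).flip x).comp (comp R (H := K) (G := H) (of R W)) =
        (comp R (of R W)).comp ((comp R).flip x) := ext fun V => h1 W V x
    exact LinearMap.congr_fun this y
  have : ((comp R).flip x).comp ((comp R (K := L) (H := K) (G := H)).flip y) =
      (comp R).flip (comp R y x) := ext fun W => h2 W y x
  exact LinearMap.congr_fun this z

theorem comp_add (y : RB R K H) (x x' : RB R H G) :
    comp R y (x + x') = comp R y x + comp R y x' := LinearMap.map_add _ _ _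

theorem add_comp (y y' : RB R K H) (x : RB R H G) :
    comp R (y + y') x = comp R y x + comp R y' x := LinearMap.map_add₂ _ _ _ _

theorem comp_smul (r : R) (y : RB R K H) (x : RB R H G) :
    comp R y (r • x) = r • comp R y x := LinearMap.map_smul _ _ _

theorem smul_comp (r : R) (y : RB R K H) (x : RB R H G) :
    comp R (r • y) x = r • comp R y x := LinearMap.map_smul₂ _ _ _ _

end RB

/-- A non-empty class of finite groups closed under subquotients (hence under isomorphisms) and
cartesian products. -/
structure GroupClass where
  Mem : FiniteGrp.{u} → Prop
  nonempty : ∃ G, Mem G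
  subquotient : ∀ (G K : FiniteGrp.{u}) (H : Subgroup G) (f : H →* K), Mem G →
    Function.Surjective f → Mem K
  prod : ∀ G H : FiniteGrp.{u}, Mem G → Mem H → Mem (FiniteGrp.of (G × H))

/-- The class of all finite groups. -/
def GroupClass.all : GroupClass.{u} := ⟨fun _ => True, ⟨FiniteGrp.of PUnit, trivial⟩,
  fun _ _ _ _ _ _ => trivial, fun _ _ _ _ => trivial⟩

/-- The objects of the full subcategory `R𝒟` of the biset category over `R`: the groups in `𝒟`. -/
structure BisetCat (R : Type v) [CommRing R] (D : GroupClass.{u}) where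
  grp : FiniteGrp.{u}
  mem : D.Mem grp

namespace BisetCat

variable {R : Type v} [CommRing R] {D : GroupClass.{u}}

instance : CoeSort (BisetCat R D) (Type u) := ⟨fun G => G.grp⟩

/-- Morphisms `G ⟶ H` are the elements of `RB(H, G)`. -/
noncomputable instance : Category (BisetCat R D) where
  Hom G H := RB R H G
  id G := RB.of R (FinBiset.idBiset G)
  comp f g := RB.comp R g f
  id_comp f := RB.comp_id f
  comp_id f := RB.id_comp f
  assoc f g h := (RB.comp_assoc h g f).symm

noncomputable instance (G H : BisetCat R D) : AddCommGroup (G ⟶ H) :=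
  inferInstanceAs (AddCommGroup (RB R H G))

noncomputable instance (G H : BisetCat R D) : Module R (G ⟶ H) :=
  inferInstanceAs (Module R (RB R H G))

noncomputable instance : Preadditive (BisetCat R D) where
  add_comp _ _ _ f f' g := RB.comp_add g f f'
  comp_add _ _ _ f g g' := RB.add_comp g g' f

noncomputable instance : Linear R (BisetCat R D) where
  smul_comp _ _ _ r f g := RB.comp_smul r g f
  comp_smul _ _ _ f r g := RB.smul_comp r g f

/-- The morphism `G ⟶ H` given by a finite `(H, G)`-biset. -/
noncomputable def homOf {G H : BisetCat R D} (U : FinBiset H G) : G ⟶ H := RB.of R U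

/-- The direct product of two groups in `𝒟`. -/
def prod (G H : BisetCat R D) : BisetCat R D := ⟨FiniteGrp.of (G × H), D.prod _ _ G.mem H.mem⟩

/-- The trivial group. -/
def one : BisetCat R D :=
  ⟨FiniteGrp.of PUnit, by
    obtain ⟨G, hG⟩ := D.nonempty
    exact D.subquotient G _ ⊤ (1 : (⊤ : Subgroup G) →* PUnit) hG fun x => ⟨1, rfl⟩⟩

/-- The product `φ × ψ : G × H ⟶ G' × H'` of morphisms `φ : G ⟶ G'` and `ψ : H ⟶ H'`. -/
noncomputable def cross {G G' H H' : BisetCat R D} (φ : G ⟶ G') (ψ : H ⟶ H') :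
    prod G H ⟶ prod G' H' := RB.cross R φ ψ

/-- The morphism `Iso φ : G ⟶ H` for a group isomorphism `φ : G ≃ H`. -/
noncomputable def iso {G H : BisetCat R D} (φ : G ≃* H) : G ⟶ H :=
  homOf (FinBiset.ind φ.toMonoidHom)

/-- The morphism `G ⟶ K` given by the `(K, G)`-biset `G` for a group homomorphism `φ : K → G`. -/
noncomputable def res {G K : BisetCat R D} (φ : K →* G) : G ⟶ K := homOf (FinBiset.res φ)

end BisetCat

/-! ## Green biset functors -/

open BisetCat

/-- A Green biset functor over `R𝒟`: an `R`-linear functor from `R𝒟` to `R`-modules, with bilinear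
products `A(G) × A(H) → A(G × H)` and an element of `A(1)`, which are associative, unital and
functorial. -/
structure GreenBisetFunctor (R : Type v) [CommRing R] (D : GroupClass.{u}) where
  toFunctor : BisetCat R D ⥤ ModuleCat.{w} R
  [additive : toFunctor.Additive]
  [linear : toFunctor.Linear R]
  /-- The product `a × b`. -/
  times : ∀ G H : BisetCat R D,
    toFunctor.obj G →ₗ[R] toFunctor.obj H →ₗ[R] toFunctor.obj (prod G H)
  /-- The identity element `ξ`. -/
  ξ : toFunctor.obj BisetCat.one
  assoc : ∀ (G H K : BisetCat R D) (a : toFunctor.obj G) (b : toFunctor.obj H)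
    (c : toFunctor.obj K),
    times (prod G H) K (times G H a b) c =
      toFunctor.map (iso (G := prod G (prod H K)) (H := prod (prod G H) K)
        (MulEquiv.prodAssoc (M := G) (N := H) (P := K)).symm) (times G (prod H K) a (times H K b c))
  one_times : ∀ (G : BisetCat R D) (a : toFunctor.obj G),
    toFunctor.map (iso (G := prod BisetCat.one G) (H := G)
      (MulEquiv.uniqueProd (M := G) (N := PUnit))) (times BisetCat.one G ξ a) = a
  times_one : ∀ (G : BisetCat R D) (a : toFunctor.obj G),
    toFunctor.map (iso (G := prod G BisetCat.one) (H := G)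
      (MulEquiv.prodUnique (M := G) (N := PUnit))) (times G BisetCat.one a ξ) = a
  functorial : ∀ {G G' H H' : BisetCat R D} (φ : G ⟶ G') (ψ : H ⟶ H') (a : toFunctor.obj G)
    (b : toFunctor.obj H),
    toFunctor.map (cross φ ψ) (times G H a b) =
      times G' H' (toFunctor.map φ a) (toFunctor.map ψ b)

namespace GreenBisetFunctor

variable {R : Type v} [CommRing R] {D : GroupClass.{u}} (A : GreenBisetFunctor.{u, v, w} R D)

/-- The ring product `a · b` on `A(G)`: the image of `a × b ∈ A(G × G)` under the restriction along
the diagonal `G → G × G`, i.e. the restriction to the diagonal subgroup followed by the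
isomorphism of that subgroup with `G`. -/
noncomputable def mul (G : BisetCat R D) (a b : A.toFunctor.obj G) : A.toFunctor.obj G :=
  A.toFunctor.map
    (res (G := prod G G) (K := G) ((MonoidHom.id G).prod (MonoidHom.id G))) (A.times G G a b)

/-- The unity of `A(G)`: the inflation of `ξ ∈ A(1)`. -/
noncomputable def unity (G : BisetCat R D) : A.toFunctor.obj G :=
  A.toFunctor.map (res (G := BisetCat.one) (K := G) (1 : G →* PUnit)) A.ξ

/-- For each `G`, the `R`-algebra `A(G)` is a finite dimensional split semisimple commutative
algebra, i.e. isomorphic to `Rⁿ` for some `n` (for `R` a field). -/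
def IsSplitSemisimpleCommutative : Prop :=
  ∀ G : BisetCat R D, ∃ (n : ℕ) (e : A.toFunctor.obj G ≃ₗ[R] (Fin n → R)),
    e (A.unity G) = 1 ∧ ∀ a b, e (A.mul G a b) = e a * e b

/-- A (two-sided) ideal of `A`: a biset subfunctor `I` such that `A(G) × I(H)` and `I(G) × A(H)`
are mapped into `I(G × H)`. -/
@[ext]
structure GreenIdeal where
  obj : ∀ G : BisetCat R D, Submodule R (A.toFunctor.obj G)
  map_mem : ∀ {G H : BisetCat R D} (φ : G ⟶ H) (a : A.toFunctor.obj G), a ∈ obj G →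
    A.toFunctor.map φ a ∈ obj H
  times_mem_left : ∀ (G H : BisetCat R D) (a : A.toFunctor.obj G) (b : A.toFunctor.obj H),
    b ∈ obj H → A.times G H a b ∈ obj (prod G H)
  times_mem_right : ∀ (G H : BisetCat R D) (a : A.toFunctor.obj G) (b : A.toFunctor.obj H),
    a ∈ obj G → A.times G H a b ∈ obj (prod G H)

/-- Inclusion of ideals as subfunctors. -/
def GreenIdeal.Contained {A : GreenBisetFunctor.{u, v, w} R D} (I J : A.GreenIdeal) : Prop :=
  ∀ G : BisetCat R D, I.obj G ≤ J.obj G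

end GreenBisetFunctor

/-! ### Ideals of a Green biset functor, evaluated at a group -/

namespace GreenBisetFunctor

variable {R : Type v} [CommRing R] {D : GroupClass.{u}} {A : GreenBisetFunctor.{u, v, w} R D}

/-! Inclusion, sum and intersection of ideals of $A$ are all computed separately at each group $G$,
so distributivity can be tested inside the single algebra $A(G)$. There each $I(G)$ is a two-sided
ideal, because the ring product is an external product followed by a morphism of the biset category
(`mul_mem_left`, `mul_mem_right`).

Ideals of a general ring need not form a distributive lattice. Those of $\mathbb{K}^n$ do: each is
cut out by the vanishing of a set of coordinates, and sums and intersections of ideals become unions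
and intersections of the complementary sets. The proof uses only a consequence of this structure,
von Neumann regularity: each $x \in A(G)$ has a $w$ with $x = (xw)x$ (`exists_mul_mul_eq_self`). If
$x \in I(G)$ and $x = y + z$ with $y \in J(G)$, $z \in K(G)$, then $x = (xw)y + (xw)z$. Since $xw
\in I(G)$, the first term lies in $I(G) \cap J(G)$ and the second in $I(G) \cap K(G)$. This is
`inf_sup_le`, the only inclusion needed to make a lattice distributive. -/

theorem mul_add (G : BisetCat R D) (a b c : A.toFunctor.obj G) :
    A.mul G a (b + c) = A.mul G a b + A.mul G a c := by
  simp only [mul, map_add]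

namespace GreenIdeal

/-- The product `mul` is `times` followed by restriction along the diagonal. An ideal is stable
under both operations, hence under `mul`. Together with `mul_mem_right`, this makes the value of a
Green ideal at $G$ an ideal of the ring $A(G)$; commutativity plays no part. -/
theorem mul_mem_left (I : A.GreenIdeal) {G : BisetCat R D} (a : A.toFunctor.obj G)
    {b : A.toFunctor.obj G} (hb : b ∈ I.obj G) : A.mul G a b ∈ I.obj G :=
  I.map_mem _ _ (I.times_mem_left G G a b hb)

theorem mul_mem_right (I : A.GreenIdeal) {G : BisetCat R D} {a : A.toFunctor.obj G}
    (b : A.toFunctor.obj G) (ha : a ∈ I.obj G) : A.mul G a b ∈ I.obj G :=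
  I.map_mem _ _ (I.times_mem_right G G a b ha)

/-! ### The lattice of ideals -/

instance : PartialOrder A.GreenIdeal where
  le := Contained
  le_refl _ _ := le_rfl
  le_trans _ _ _ h h' G := (h G).trans (h' G)
  le_antisymm _ _ h h' := GreenIdeal.ext (funext fun G => le_antisymm (h G) (h' G))

/-- The sum of two ideals. -/
instance : Max A.GreenIdeal where
  max I J :=
    { obj := fun G => I.obj G ⊔ J.obj G
      map_mem := fun φ a ha => by
        obtain ⟨x, hx, y, hy, rfl⟩ := Submodule.mem_sup.1 ha
        rw [map_add]
        exact Submodule.add_mem_sup (I.map_mem φ x hx) (J.map_mem φ y hy)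
      times_mem_left := fun G H a b hb => by
        obtain ⟨x, hx, y, hy, rfl⟩ := Submodule.mem_sup.1 hb
        rw [map_add]
        exact Submodule.add_mem_sup (I.times_mem_left G H a x hx) (J.times_mem_left G H a y hy)
      times_mem_right := fun G H a b ha => by
        obtain ⟨x, hx, y, hy, rfl⟩ := Submodule.mem_sup.1 ha
        rw [LinearMap.map_add₂]
        exact Submodule.add_mem_sup (I.times_mem_right G H x b hx)
          (J.times_mem_right G H y b hy) }

/-- The intersection of two ideals. -/
instance : Min A.GreenIdeal where
  min I J :=
    { obj := fun G => I.obj G ⊓ J.obj G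
      map_mem := fun φ a ha => ⟨I.map_mem φ a ha.1, J.map_mem φ a ha.2⟩
      times_mem_left := fun G H a b hb =>
        ⟨I.times_mem_left G H a b hb.1, J.times_mem_left G H a b hb.2⟩
      times_mem_right := fun G H a b ha =>
        ⟨I.times_mem_right G H a b ha.1, J.times_mem_right G H a b ha.2⟩ }

/-- At each $G$ the operations are those of the lattice of submodules of $A(G)$, so every axiom is
inherited from there. Split semisimplicity enters only with distributivity. -/
instance : Lattice A.GreenIdeal where
  sup I J := I ⊔ J
  le_sup_left I J G := (le_sup_left : I.obj G ≤ I.obj G ⊔ J.obj G)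
  le_sup_right I J G := (le_sup_right : J.obj G ≤ I.obj G ⊔ J.obj G)
  sup_le _ _ _ h h' G := sup_le (h G) (h' G)
  inf I J := I ⊓ J
  inf_le_left I J G := (inf_le_left : I.obj G ⊓ J.obj G ≤ I.obj G)
  inf_le_right I J G := (inf_le_right : I.obj G ⊓ J.obj G ≤ J.obj G)
  le_inf _ _ _ h h' G := le_inf (h G) (h' G)

end GreenIdeal

/-! ### Regularity and distributivity -/

/-- Split semisimple commutative algebras over a field are von Neumann regular. -/
theorem IsSplitSemisimpleCommutative.exists_mul_mul_eq_self {𝕂 : Type v} [Field 𝕂]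
    {A : GreenBisetFunctor.{u, v, w} 𝕂 D} (hA : A.IsSplitSemisimpleCommutative)
    {G : BisetCat 𝕂 D} (x : A.toFunctor.obj G) : ∃ w, A.mul G (A.mul G x w) x = x := by
  obtain ⟨n, e, -, he⟩ := hA G
  -- The witness is the coordinatewise inverse in $\mathbb{K}^n$. With the convention $0^{-1} = 0$,
  -- the identity $t\,t^{-1}\,t = t$ also holds at vanishing coordinates, so $x$ need not be a unit.
  refine ⟨e.symm fun i => (e x i)⁻¹, e.injective ?_⟩
  ext i
  simp [he, mul_inv_mul_cancel]

/-- Regularity supplies a factor $xw \in I(G)$ that fixes $x$ under left multiplication. Multiplying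
a decomposition of $x$ by it pushes both summands into $I(G)$ without leaving $J(G)$ or $K(G)$. The
reverse inclusion holds in every lattice. -/
theorem IsSplitSemisimpleCommutative.inf_sup_le {𝕂 : Type v} [Field 𝕂]
    {A : GreenBisetFunctor.{u, v, w} 𝕂 D} (hA : A.IsSplitSemisimpleCommutative)
    (I J K : A.GreenIdeal) : I ⊓ (J ⊔ K) ≤ I ⊓ J ⊔ I ⊓ K := by
  rintro G x ⟨hI, hJK⟩
  obtain ⟨w, hw⟩ := hA.exists_mul_mul_eq_self x
  obtain ⟨y, hy, z, hz, hyz⟩ := Submodule.mem_sup.1 hJK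
  have hxw : A.mul G x w ∈ I.obj G := I.mul_mem_right w hI
  rw [← hw]
  -- Only the right-hand factor of $(xw)x$ is expanded as $y + z$; the $x$ inside $xw$ stays intact,
  -- since it is what places both terms in $I(G)$.
  nth_rewrite 2 [← hyz]
  rw [mul_add]
  exact Submodule.add_mem_sup ⟨I.mul_mem_right y hxw, J.mul_mem_left _ hy⟩
    ⟨I.mul_mem_right z hxw, K.mul_mem_left _ hz⟩

end GreenBisetFunctor

theorem mainTheorem5 {𝕂 : Type v} [Field 𝕂] [CharZero 𝕂] (D : GroupClass.{u})
    (A : GreenBisetFunctor.{u, v, w} 𝕂 D) (hA : A.IsSplitSemisimpleCommutative) :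
    ∃ L : DistribLattice A.GreenIdeal,
      (∀ I J : A.GreenIdeal, L.le I J ↔ I.Contained J) ∧
      (∀ (I J : A.GreenIdeal) (G : BisetCat 𝕂 D), (L.sup I J).obj G = I.obj G ⊔ J.obj G) ∧
      (∀ (I J : A.GreenIdeal) (G : BisetCat 𝕂 D), (L.inf I J).obj G = I.obj G ⊓ J.obj G) :=
  -- `ofInfSupLe` keeps the order, join and meet of the existing lattice instance, so the three
  -- descriptions hold by definition.
  ⟨DistribLattice.ofInfSupLe hA.inf_sup_le, fun _ _ => Iff.rfl, fun _ _ _ => rfl,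
    fun _ _ _ => rfl⟩
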